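/- Let $L$ be a first-order language and let $\mathcal{C}$ be a class of finite $L$-structures. For a tuple $\bar y$ of variables put $(\mathcal{C},\bar y)=\{(M,\bar b): M\in\mathcal{C},\ \bar b\in M^{|\bar y|}\}$. A partition $\Pi$ of $(\mathcal{C},\bar y)$ is called $\emptyset$-definable if for every part $\pi\in\Pi$ there is an $L$-formula $\theta_\pi(\bar y)$ without parameters such that, for every $M\in\mathcal{C}$, $\theta_\pi(M^{|\bar y|})=\{\bar b\in M^{|\bar y|}:(M,\bar b)\in\pi\}$. For a set $\mathcal{R}$ of functions $\mathcal{C}\to\mathbb{R}^{\ge 0}$, the class $\mathcal{C}$ is an $\mathcal{R}$-multidimensional exact class if for every $L$-formula $\phi(\bar x;\bar y)$ there are a finite $\emptyset$-definable partition $\Pi$ of $(\mathcal{C},\bar y)$ and functions $h_\pi\in\mathcal{R}$ $(\pi\in\Pi)$ such that $$|\phi(M^{|\bar x|};\bar b)|=h_\pi(M)\qquad\text{for all }\pi\in\Pi\text{ and all }(M,\bar b)\in\pi .$$ It is a multidimensional exact class (m.e.c.) if it is an $\mathcal{R}$-multidimensional exact class for some such $\mathcal{R}$. **Theorem.** (i)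 Let $R$ be a (unital, associative) ring. The class of all finite left $R$-modules, in the language $(+,-,0,(f_r)_{r\in R})$ of left $R$-modules, where $f_r$ is a unary function symbol for multiplication by $r$, is a m.e.c. (ii) The class of all finite abelian groups, in the language $(+,-,0)$, is a m.e.c. -/

import Mathlib

open CategoryTheory
open scoped NNReal

universe u v w

namespace MultiExact

section General

variable {L : FirstOrder.Language.{u, v}}

/-- The cardinality of the definable set `φ(M^m; b)`, for a formula `φ(x; y)` whose variables are
split into an `m`-tuple `x` and an `n`-tuple `y`. -/
noncomputable def fiberCard {m n : ℕ} (φ : L.Formula (Fin m ⊕ Fin n)) (M : Type w) [L.Structure M]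
    (b : Fin n → M) : ℕ :=
  Nat.card {a : Fin m → M // φ.Realize (Sum.elim a b)}

/-- `(C, y)`: the pairs `(M, b)` of a member `M` of the class `C` and an `n`-tuple `b` from `M`. -/
abbrev Pointed (C : Set (Bundled.{w} L.Structure)) (n : ℕ) :=
  Σ M : C, (Fin n → M.1)

/-- A set `π` of pairs `(M, b)` is `∅`-definable if a single formula without parameters
cuts out, in every `M` in `C`, the set of tuples `b` with `(M, b) ∈ π`. -/
def IsDefinablePart {C : Set (Bundled.{w} L.Structure)} {n : ℕ} (π : Set (Pointed C n)) : Prop :=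
  ∃ θ : L.Formula (Fin n), ∀ (M : C) (b : Fin n → M.1), θ.Realize b ↔ (⟨M, b⟩ : Pointed C n) ∈ π

/-- `P` is a finite `∅`-definable partition of `(C, y)`. -/
def IsFiniteDefinablePartition {C : Set (Bundled.{w} L.Structure)} {n : ℕ}
    (P : Set (Set (Pointed C n))) : Prop :=
  Setoid.IsPartition P ∧ P.Finite ∧ ∀ π ∈ P, IsDefinablePart π

/-- The class `C` of finite `L`-structures is an `R`-multidimensional exact class, for a set `R`
of functions `C → ℝ≥0`. -/
def IsMultidimExactClassFor (C : Set (Bundled.{w} L.Structure)) (R : Set (C → ℝ≥0)) : Prop :=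
  (∀ M ∈ C, Finite M) ∧
  ∀ (m n : ℕ) (φ : L.Formula (Fin m ⊕ Fin n)),
    ∃ P : Set (Set (Pointed C n)), IsFiniteDefinablePartition P ∧
      ∃ h : P → (C → ℝ≥0), (∀ π, h π ∈ R) ∧
        ∀ (π : P) (M : C) (b : Fin n → M.1), (⟨M, b⟩ : Pointed C n) ∈ π.1 →
          (fiberCard φ M.1 b : ℝ≥0) = h π M

/-- Multidimensional exact class, the set of measuring functions being unrestricted. -/
def IsMultidimExactClass (C : Set (Bundled.{w} L.Structure)) : Prop :=
  ∃ R : Set (C → ℝ≥0), IsMultidimExactClassFor C R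

end General

/-- Function symbols `+`, `-`, `0` and `f_r` (`r ∈ R`) of the language of left `R`-modules. -/
inductive ModuleFunc (R : Type u) : ℕ → Type u
  | add : ModuleFunc R 2
  | neg : ModuleFunc R 1
  | zero : ModuleFunc R 0
  | smul (r : R) : ModuleFunc R 1

/-- The language `(+, -, 0, (f_r)_{r ∈ R})` of left `R`-modules. -/
def moduleLanguage (R : Type u) : FirstOrder.Language.{u, 0} where
  Functions := ModuleFunc R
  Relations := fun _ => Empty

/-- A left `R`-module as a structure in the language of `R`-modules. -/
@[reducible] def moduleStructure (R : Type u) [Ring R] (M : Type w) [AddCommGroup M] [Module R M] :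
    (moduleLanguage R).Structure M where
  funMap := fun {_} f => match f with
    | .add => fun v => v 0 + v 1
    | .neg => fun v => -v 0
    | .zero => fun _ => 0
    | .smul r => fun v => r • v 0
  RelMap := fun {_} r => Empty.elim r

/-- The class of all finite left `R`-modules, in the language of `R`-modules. -/
def finiteModules (R : Type u) [Ring R] : Set (Bundled.{w} (moduleLanguage R).Structure) :=
  {N | ∃ (M : Type w) (_ : AddCommGroup M) (_ : Module R M), Finite M ∧
    N = ⟨M, moduleStructure R M⟩}

/-- Function symbols `+`, `-`, `0` of the language of (additively written) abelian groups. -/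
inductive AbGroupFunc : ℕ → Type
  | add : AbGroupFunc 2
  | neg : AbGroupFunc 1
  | zero : AbGroupFunc 0

/-- The language `(+, -, 0)` of abelian groups. -/
def abGroupLanguage : FirstOrder.Language.{0, 0} where
  Functions := AbGroupFunc
  Relations := fun _ => Empty

/-- An abelian group as a structure in the language of abelian groups. -/
@[reducible] def abGroupStructure (A : Type w) [AddCommGroup A] : abGroupLanguage.Structure A where
  funMap := fun {_} f => match f with
    | .add => fun v => v 0 + v 1
    | .neg => fun v => -v 0
    | .zero => fun _ => 0
  RelMap := fun {_} r => Empty.elim r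

/-- The class of all finite abelian groups, in the language of abelian groups. -/
def finiteAbGroups : Set (Bundled.{w} abGroupLanguage.Structure) :=
  {N | ∃ (A : Type w) (_ : AddCommGroup A), Finite A ∧ N = ⟨A, abGroupStructure A⟩}

end MultiExact

namespace MultiExact

/-! ### Combinatorics of finite families of sets -/

section Counting

variable {ι X : Type*}

/-! The measuring functions are unrestricted, so it suffices to compare fibres inside a single `M`:
finitely many formulas in `y` must determine the cardinality of the fibre of `φ`. Equations define
cosets or the empty set, and such relations are closed under intersection and projection. Any two
nonempty fibres of one are translates of each other. Hence, if the same intersections of fibres over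
`b` and `b'` are nonempty, all these intersections are equinumerous, and a permutation matches the
two families (`exists_perm_of_isAffineRel`). This permutation carries the induction through
quantifiers (`IsControlledBy.all`) and, on tuples, gives the final count (`exists_fiberCard_eq`). -/

open Finset in
/-- Two maps into a finite power set whose preimages of all up-sets `{U | T ⊆ U}` are equinumerous
have equinumerous fibres. -/
theorem card_fiber_eq_of_card_superset_eq [Fintype ι] [DecidableEq ι] [Fintype X]
    {f g : X → Finset ι} (h : ∀ T, #{x | T ⊆ f x} = #{x | T ⊆ g x}) (T : Finset ι) :
    #{x | f x = T} = #{x | g x = T} := by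
  have key : ∀ k : X → Finset ι,
      #{x | T ⊆ k x} = #{x | k x = T} + ∑ U ∈ univ.filter (T ⊂ ·), #{x | k x = U} := by
    intro k
    have hs : (univ.filter (T ⊆ ·) : Finset (Finset ι)) = insert T (univ.filter (T ⊂ ·)) := by
      ext U
      simp only [mem_filter, mem_univ, true_and, mem_insert]
      rw [subset_iff_ssubset_or_eq, or_comm, eq_comm]
    rw [card_eq_sum_card_fiberwise (f := k) (t := univ.filter (T ⊆ ·)) (by intro x; simp), hs]
    have hfib : ∀ U, T ⊆ U →
        #{x ∈ ({x | T ⊆ k x} : Finset X) | k x = U} = #{x | k x = U} := by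
      intro U hU
      congr 1
      ext x
      simp only [mem_filter, mem_univ, true_and, and_iff_right_iff_imp]
      rintro rfl
      exact hU
    rw [sum_insert (by simp), hfib T subset_rfl]
    congr 1
    exact sum_congr rfl fun U hU => hfib U (mem_filter.1 hU).2.subset
  -- Möbius inversion by downward recursion: fibres over proper supersets of `T` already agree.
  have hsum : ∑ U ∈ univ.filter (T ⊂ ·), #{x | f x = U} =
      ∑ U ∈ univ.filter (T ⊂ ·), #{x | g x = U} :=
    sum_congr rfl fun U hU => by
      have : T ⊂ U := (mem_filter.1 hU).2
      exact card_fiber_eq_of_card_superset_eq h U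
  have := h T
  rw [key f, key g, hsum] at this
  exact Nat.add_right_cancel this
termination_by Fintype.card ι - #T
decreasing_by
  have h1 := card_lt_card this
  have h2 := card_le_univ U
  omega

/-- Two finite families of subsets of a finite set, all of whose intersections are equinumerous,
are carried to each other by a permutation. -/
theorem exists_perm_of_card_inter_eq [Finite ι] [Finite X] {A B : ι → X → Prop}
    (h : ∀ S : Set ι, Nat.card {x // ∀ i ∈ S, A i x} = Nat.card {x // ∀ i ∈ S, B i x}) :
    ∃ e : Equiv.Perm X, ∀ i x, A i x ↔ B i (e x) := by
  classical
  cases nonempty_fintype ι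
  cases nonempty_fintype X
  let f : X → Finset ι := fun x => {i | A i x}
  let g : X → Finset ι := fun x => {i | B i x}
  have hfg : ∀ T, Nonempty ({x // f x = T} ≃ {x // g x = T}) := by
    intro T
    rw [← Fintype.card_eq, Fintype.card_subtype, Fintype.card_subtype]
    refine card_fiber_eq_of_card_superset_eq (fun T => ?_) T
    have := h T
    rw [Nat.card_eq_fintype_card, Nat.card_eq_fintype_card, Fintype.card_subtype,
      Fintype.card_subtype] at this
    simpa [f, g, Finset.subset_iff] using this
  let e' := fun T => (hfg T).some
  let e : Equiv.Perm X := (Equiv.sigmaFiberEquiv f).symm.trans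
    ((Equiv.sigmaCongrRight e').trans (Equiv.sigmaFiberEquiv g))
  have he : ∀ x, g (e x) = f x := fun x => (e' (f x) ⟨x, rfl⟩).2
  refine ⟨e, fun i x => ?_⟩
  have := congrArg (i ∈ ·) (he x)
  simpa [f, g] using this.symm.to_iff

end Counting

/-! ### Cosets and their fibres -/

section Affine

variable {ι G X : Type*} [AddCommGroup G] [AddCommGroup X]

/-- A relation between two abelian groups is affine if its graph is closed under `p - q + r`, that
is, empty or a coset. -/
def IsAffineRel (P : G → X → Prop) : Prop :=
  ∀ ⦃a b c x y z⦄, P a x → P b y → P c z → P (a - b + c) (x - y + z)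

/-- Any two nonempty fibres of an affine relation are equinumerous. -/
theorem IsAffineRel.card_fiber_eq [Finite X] {P : G → X → Prop} (hP : IsAffineRel P) {a b : G}
    (h : (∃ x, P a x) ↔ ∃ x, P b x) : Nat.card {x // P a x} = Nat.card {x // P b x} := by
  by_cases ha : ∃ x, P a x
  · obtain ⟨y, hy⟩ := h.1 ha
    obtain ⟨x, hx⟩ := ha
    -- Translation by `y - x` maps the fibre over `a` onto the fibre over `b`.
    refine Nat.card_congr
      ((Equiv.addRight (-x + y)).subtypeEquiv fun z => ⟨fun hz => ?_, fun hz => ?_⟩)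
    · have := hP hz hx hy
      rwa [sub_self, zero_add, sub_add, sub_eq_add_neg, neg_sub, sub_eq_neg_add] at this
    · have := hP hz hy hx
      rwa [sub_self, zero_add, show (Equiv.addRight (-x + y)) z = z + (-x + y) from rfl, ← add_assoc, add_sub_cancel_right,
        neg_add_cancel_right] at this
  · have : IsEmpty {x // P a x} := ⟨fun x => ha ⟨x, x.2⟩⟩
    have : IsEmpty {x // P b x} := ⟨fun x => ha (h.2 ⟨x, x.2⟩)⟩
    simp

/-- If the same intersections of fibres over `a` and over `b` of finitely many affine relations are
nonempty, then a permutation carries the fibres over `a` to those over `b`. -/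
theorem exists_perm_of_isAffineRel [Finite ι] [Finite X] {P : ι → G → X → Prop}
    (hP : ∀ i, IsAffineRel (P i)) {a b : G}
    (h : ∀ S : Set ι, (∃ x, ∀ i ∈ S, P i a x) ↔ ∃ x, ∀ i ∈ S, P i b x) :
    ∃ e : Equiv.Perm X, ∀ i x, P i a x ↔ P i b (e x) :=
  exists_perm_of_card_inter_eq fun S =>
    IsAffineRel.card_fiber_eq (P := fun a x => ∀ i ∈ S, P i a x)
      (fun _ _ _ _ _ _ h₁ h₂ h₃ i hi => hP i (h₁ i hi) (h₂ i hi) (h₃ i hi)) (h S)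

end Affine

/-! ### Control of formulas by affine formulas -/

section Formulas

open FirstOrder.Language

variable {L : FirstOrder.Language.{u, v}} {C : Set (Bundled.{w} L.Structure)}
  [∀ M : C, AddCommGroup M.1] {α : Type} {n : ℕ}

variable (C) in
/-- The formula defines an affine relation in every structure of the class. -/
def IsAffineFormula (ψ : L.BoundedFormula α n) : Prop :=
  ∀ M : C, IsAffineRel fun (v : α → M.1) (x : Fin n → M.1) => ψ.Realize v x

variable (C) in
/-- In each structure of the class, the truth value of `φ` depends only on those of the `ψ i`. -/
def IsControlledBy {ι : Type} (φ : L.BoundedFormula α n) (ψ : ι → L.BoundedFormula α n) : Prop :=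
  ∀ (M : C) (v v' : α → M.1) (x x' : Fin n → M.1),
    (∀ i, (ψ i).Realize v x ↔ (ψ i).Realize v' x') → (φ.Realize v x ↔ φ.Realize v' x')

theorem snoc_sub_add {M : Type*} [AddCommGroup M] (x y z : Fin n → M) (a b c : M) :
    (Fin.snoc (x - y + z) (a - b + c) : Fin (n + 1) → M) =
      (Fin.snoc x a : Fin (n + 1) → M) - (Fin.snoc y b : Fin (n + 1) → M) +
        (Fin.snoc z c : Fin (n + 1) → M) := by
  ext i
  refine Fin.lastCases ?_ (fun i => ?_) i <;> simp

variable (C) in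
/-- The function symbols are interpreted by additive maps in every structure of the class. -/
def HasAdditiveFunctions : Prop :=
  ∀ (M : C) (k : ℕ) (f : L.Functions k) (v w : Fin k → M.1),
    Structure.funMap f (v + w) = (Structure.funMap f v + Structure.funMap f w : M.1)

theorem HasAdditiveFunctions.realize_sub_add (hC : HasAdditiveFunctions C) (M : C) {β : Type*}
    (t : L.Term β) (u v w : β → M.1) :
    t.realize (u - v + w) = t.realize u - t.realize v + t.realize w := by
  induction t with
  | var => rfl
  | func f ts ih =>
    let F := AddMonoidHom.mk' (fun v : Fin _ → M.1 => (Structure.funMap f v : M.1)) (hC M _ f)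
    simp only [Term.realize, ih]
    have := F.map_add ((fun i => (ts i).realize u) - fun i => (ts i).realize v)
      (fun i => (ts i).realize w)
    rwa [map_sub] at this

theorem HasAdditiveFunctions.isAffineFormula_equal (hC : HasAdditiveFunctions C)
    (t₁ t₂ : L.Term (α ⊕ Fin n)) : IsAffineFormula C (t₁.bdEqual t₂) := by
  intro M a b c x y z h₁ h₂ h₃
  have hs : Sum.elim (a - b + c) (x - y + z) = Sum.elim a x - Sum.elim b y + Sum.elim c z := by
    ext (i | i) <;> rfl
  simp only [BoundedFormula.realize_bdEqual] at *
  rw [hs, hC.realize_sub_add, hC.realize_sub_add, h₁, h₂, h₃]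

theorem IsAffineFormula.ex_iInf {ι : Type} [Finite ι] {ψ : ι → L.BoundedFormula α (n + 1)}
    (hψ : ∀ i, IsAffineFormula C (ψ i)) (S : Set ι) :
    IsAffineFormula C (BoundedFormula.iInf fun i : S => ψ i).ex := by
  intro M a b c x y z h₁ h₂ h₃
  simp only [BoundedFormula.realize_ex, BoundedFormula.realize_iInf] at *
  obtain ⟨r, hr⟩ := h₁
  obtain ⟨s, hs⟩ := h₂
  obtain ⟨t, ht⟩ := h₃
  refine ⟨r - s + t, fun i => ?_⟩
  rw [snoc_sub_add]
  exact hψ i M (hr i) (hs i) (ht i)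

variable [∀ M : C, Finite M.1]

/-- The formulas indexed by `S` record which intersections of fibres are nonempty. Agreement on them
yields a permutation of `M` along which the quantified variable can be substituted. -/
theorem IsControlledBy.all {ι : Type} [Finite ι] {φ : L.BoundedFormula α (n + 1)}
    {ψ : ι → L.BoundedFormula α (n + 1)} (hψ : ∀ i, IsAffineFormula C (ψ i))
    (h : IsControlledBy C φ ψ) :
    IsControlledBy C φ.all fun S : Set ι => (BoundedFormula.iInf fun i : S => ψ i).ex := by
  intro M v v' x x' hS
  let P : ι → ((α → M.1) × (Fin n → M.1)) → M.1 → Prop :=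
    fun i p a => (ψ i).Realize p.1 (Fin.snoc p.2 a)
  have hP : ∀ i, IsAffineRel (P i) := fun i p q r a b c h₁ h₂ h₃ => by
    have := hψ i M h₁ h₂ h₃
    rwa [← snoc_sub_add] at this
  obtain ⟨e, he⟩ := exists_perm_of_isAffineRel hP (a := (v, x)) (b := (v', x')) fun S => by
    simpa [P] using hS S
  simp only [BoundedFormula.realize_all]
  rw [← e.forall_congr_right (q := fun a => φ.Realize v' (Fin.snoc x' a))]
  exact forall_congr' fun a => h M _ _ _ _ fun i => he i a

/-- Over finite abelian groups with additive operations, every formula is controlled by finitely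
many affine formulas. -/
theorem HasAdditiveFunctions.exists_isControlledBy [L.IsAlgebraic] (hC : HasAdditiveFunctions C)
    (φ : L.BoundedFormula α n) :
    ∃ (ι : Type) (_ : Finite ι) (ψ : ι → L.BoundedFormula α n),
      (∀ i, IsAffineFormula C (ψ i)) ∧ IsControlledBy C φ ψ := by
  induction φ with
  | falsum => exact ⟨Empty, inferInstance, nofun, nofun, fun _ _ _ _ _ _ => Iff.rfl⟩
  | equal t₁ t₂ =>
    exact ⟨Unit, inferInstance, fun _ => t₁.bdEqual t₂,
      fun _ => hC.isAffineFormula_equal t₁ t₂, fun _ _ _ _ _ h => h ()⟩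
  | rel r => exact isEmptyElim r
  | imp _ _ ih₁ ih₂ =>
    obtain ⟨ι₁, _, ψ₁, hψ₁, h₁⟩ := ih₁
    obtain ⟨ι₂, _, ψ₂, hψ₂, h₂⟩ := ih₂
    refine ⟨ι₁ ⊕ ι₂, inferInstance, Sum.elim ψ₁ ψ₂, Sum.rec hψ₁ hψ₂, fun M v v' x x' h => ?_⟩
    exact imp_congr (h₁ M v v' x x' fun i => h (.inl i)) (h₂ M v v' x x' fun i => h (.inr i))
  | all _ ih =>
    obtain ⟨ι, _, ψ, hψ, h⟩ := ih
    exact ⟨Set ι, inferInstance, _, IsAffineFormula.ex_iInf hψ, h.all hψ⟩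

/-- The cardinality of a fibre depends only on the truth values of finitely many formulas. -/
theorem HasAdditiveFunctions.exists_fiberCard_eq [L.IsAlgebraic] (hC : HasAdditiveFunctions C)
    {m : ℕ} (φ : L.Formula (Fin m ⊕ Fin n)) :
    ∃ (κ : Type) (_ : Finite κ) (θ : κ → L.Formula (Fin n)), ∀ (M : C) (b b' : Fin n → M.1),
      (∀ k, (θ k).Realize b ↔ (θ k).Realize b') → fiberCard φ M.1 b = fiberCard φ M.1 b' := by
  obtain ⟨ι, _, ψ, hψ, h⟩ := hC.exists_isControlledBy φ
  -- `iExs` binds the right summand, so `x` and `y` are swapped first.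
  refine ⟨Set ι, inferInstance, fun S =>
    ((Formula.iInf fun i : S => (ψ i : L.Formula _)).relabel Sum.swap).iExs (Fin m),
    fun M b b' hS => ?_⟩
  let P : ι → (Fin n → M.1) → (Fin m → M.1) → Prop :=
    fun i b a => Formula.Realize (ψ i) (Sum.elim a b)
  have hP : ∀ i, IsAffineRel (P i) := fun i b b' b'' a a' a'' h₁ h₂ h₃ => by
    have hs : Sum.elim (a - a' + a'') (b - b' + b'') =
        Sum.elim a b - Sum.elim a' b' + Sum.elim a'' b'' := by
      ext (i | i) <;> rfl
    have := hψ i M h₁ h₂ h₃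
    rwa [← hs, Subsingleton.elim (_ - _ + _ : Fin 0 → M.1) default] at this
  obtain ⟨e, he⟩ := exists_perm_of_isAffineRel hP (a := b) (b := b') fun S => by
    simpa [P, Formula.realize_relabel] using hS S
  exact Nat.card_congr (e.subtypeEquiv fun a => h M _ _ _ _ fun i => he i a)

theorem exists_isFiniteDefinablePartition {L : FirstOrder.Language.{u, v}}
    (C : Set (Bundled.{w} L.Structure)) {κ : Type} [Finite κ] (θ : κ → L.Formula (Fin n)) :
    ∃ P : Set (Set (Pointed C n)), IsFiniteDefinablePartition P ∧
      ∀ π ∈ P, ∀ p ∈ π, ∀ q ∈ π, ∀ k, (θ k).Realize p.2 ↔ (θ k).Realize q.2 := by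
  classical
  let τ : Pointed C n → Set κ := fun p => {k | (θ k).Realize p.2}
  refine ⟨(Setoid.ker τ).classes,
    ⟨Setoid.isPartition_classes _, Setoid.finite_classes_ker τ, ?_⟩, ?_⟩
  · rintro _ ⟨q, rfl⟩
    -- The conjunction fixing the truth value of every `θ k` as at `q`.
    refine ⟨Formula.iInf fun k => if k ∈ τ q then θ k else (θ k).not, fun M b => ?_⟩
    rw [Formula.realize_iInf, Set.mem_ofPred_eq, Setoid.ker_def, Set.ext_iff]
    refine forall_congr' fun k => ?_
    by_cases hk : k ∈ τ q
    · simp [hk, τ]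
    · simp only [hk, if_false, Formula.realize_not, iff_false]
      rfl
  · rintro _ ⟨r, rfl⟩ p hp q hq k
    exact Set.ext_iff.1 ((Setoid.ker_def.1 hp).trans (Setoid.ker_def.1 hq).symm) k

theorem HasAdditiveFunctions.isMultidimExactClass [L.IsAlgebraic] (hC : HasAdditiveFunctions C) :
    IsMultidimExactClass C := by
  classical
  refine ⟨Set.univ, fun M hM => inferInstanceAs (Finite (⟨M, hM⟩ : C).1), fun m n φ => ?_⟩
  obtain ⟨κ, _, θ, hθ⟩ := hC.exists_fiberCard_eq φ
  obtain ⟨P, hP, hPθ⟩ := exists_isFiniteDefinablePartition C θ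
  -- Any representative of `π` over `M` gives the same value; the `0` occurs only where `π` has no
  -- point over `M`.
  refine ⟨P, hP, fun π M => if h : ∃ b : Fin n → M.1, (⟨M, b⟩ : Pointed C n) ∈ π.1 then
    fiberCard φ M.1 h.choose else 0, fun _ => Set.mem_univ _, fun π M b hb => ?_⟩
  have h : ∃ b : Fin n → M.1, (⟨M, b⟩ : Pointed C n) ∈ π.1 := ⟨b, hb⟩
  simp only [dif_pos h]
  rw [hθ M b h.choose (hPθ π π.2 ⟨M, b⟩ hb ⟨M, _⟩ h.choose_spec)]

end Formulas

instance (R : Type u) : (moduleLanguage R).IsAlgebraic := fun _ => inferInstanceAs (IsEmpty Empty)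

instance : abGroupLanguage.IsAlgebraic := fun _ => inferInstanceAs (IsEmpty Empty)

theorem isMultidimExactClass_finiteModules (R : Type u) [Ring R] :
    IsMultidimExactClass (finiteModules.{u, w} R) := by
  have key : ∀ N : finiteModules.{u, w} R, ∃ _ : AddCommGroup N.1, Finite N.1 ∧
      ∀ (k : ℕ) (f : (moduleLanguage R).Functions k) (v w : Fin k → N.1),
        FirstOrder.Language.Structure.funMap f (v + w) =
          (FirstOrder.Language.Structure.funMap f v +
            FirstOrder.Language.Structure.funMap f w : N.1) := by
    rintro ⟨_, M, _, _, hM, rfl⟩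
    refine ⟨inferInstanceAs (AddCommGroup M), hM, fun k f (v w : Fin k → M) => ?_⟩
    cases f with
    | add => exact add_add_add_comm (v 0) (w 0) (v 1) (w 1)
    | neg => exact neg_add (v 0) (w 0)
    | zero => exact (add_zero (0 : M)).symm
    | smul r => exact smul_add r (v 0) (w 0)
  choose _ _ h using key
  exact HasAdditiveFunctions.isMultidimExactClass h

theorem isMultidimExactClass_finiteAbGroups : IsMultidimExactClass finiteAbGroups.{w} := by
  have key : ∀ N : finiteAbGroups.{w}, ∃ _ : AddCommGroup N.1, Finite N.1 ∧
      ∀ (k : ℕ) (f : abGroupLanguage.Functions k) (v w : Fin k → N.1),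
        FirstOrder.Language.Structure.funMap f (v + w) =
          (FirstOrder.Language.Structure.funMap f v +
            FirstOrder.Language.Structure.funMap f w : N.1) := by
    rintro ⟨_, A, _, hA, rfl⟩
    refine ⟨inferInstanceAs (AddCommGroup A), hA, fun k f (v w : Fin k → A) => ?_⟩
    cases f with
    | add => exact add_add_add_comm (v 0) (w 0) (v 1) (w 1)
    | neg => exact neg_add (v 0) (w 0)
    | zero => exact (add_zero (0 : A)).symm
  choose _ _ h using key
  exact HasAdditiveFunctions.isMultidimExactClass h

end MultiExact

theorem mainTheorem7 :
    (∀ (R : Type u) [Ring R],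
      MultiExact.IsMultidimExactClass (MultiExact.finiteModules.{u, w} R)) ∧
    MultiExact.IsMultidimExactClass MultiExact.finiteAbGroups.{w} :=
  ⟨fun R _ => MultiExact.isMultidimExactClass_finiteModules R,
    MultiExact.isMultidimExactClass_finiteAbGroups⟩
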